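/- Let $d\in\mathbb{N}$, let $\mathbb{D}^d\subset\mathbb{C}^d$ be the open unit polydisc, and let $f$ be a bounded holomorphic function on $\mathbb{D}^d$, with power series $f(z)=\sum_{\alpha\in\mathbb{N}_0^d}a_\alpha z^\alpha$. For a commuting tuple $\mathbf{T}=(T_1,\dots,T_d)$ of bounded operators on a complex Hilbert space with $\|T_i\|<1$ for all $i$ (a commuting tuple of strict contractions), put $f(\mathbf{T})=\sum_\alpha a_\alpha T_1^{\alpha_1}\cdots T_d^{\alpha_d}$, and define the Schur--Agler norm \[ \|f\|_{\mathrm{SA}}=\sup\{\|f(\mathbf{T})\| : \mathbf{T}\text{ is a commuting }d\text{-tuple of strict contractions on a complex Hilbert space}\}\in[0,\infty]. \] Let $\mathcal{C}_d$ be the set of all commuting $d$-tuples $\mathbf{T}$ of complex $n\times n$ matrices ($n$ arbitrary) such that every $T_i$ has operator norm $<1$ on Euclidean $\mathbb{C}^n$, and such that $\mathbf{T}$ is cyclic: there is $\xi\in\mathbb{C}^n$ for which $\{p(\mathbf{T})\xi : p\in\mathbb{C}[z_1,\dots,z_d]\}$ is dense in $\mathbb{C}^n$. Call $\mathbf{T}$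 jointly nilpotent if there is $N$ with $T_1^{\alpha_1}\cdots T_d^{\alpha_d}=0$ whenever $\alpha_1+\dots+\alpha_d\ge N$, and jointly diagonalizable if there is an invertible matrix $S$ such that $S^{-1}T_iS$ is diagonal for every $i$. Then, as an equality in $[0,\infty]$, \[ \|f\|_{\mathrm{SA}}=\sup\{\|f(\mathbf{T})\| : \mathbf{T}\in\mathcal{C}_d\text{ is jointly nilpotent}\}=\sup\{\|f(\mathbf{T})\| : \mathbf{T}\in\mathcal{C}_d\text{ is jointly diagonalizable}\}. \] -/

import Mathlib

open scoped ENNReal Matrix.Norms.L2Operator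

universe u

namespace SchurAgler

/-- The open unit polydisc in `ℂ^d`. -/
def polydisc (d : ℕ) : Set (Fin d → ℂ) := {z | ∀ i, ‖z i‖ < 1}

/-- Membership in `H^∞` of the polydisc: `f` is holomorphic and bounded there
(values off the polydisc are irrelevant). -/
def IsHInfty {d : ℕ} (f : (Fin d → ℂ) → ℂ) : Prop :=
  DifferentiableOn ℂ f (polydisc d) ∧ ∃ C : ℝ, ∀ z ∈ polydisc d, ‖f z‖ ≤ C

/-- The complex partial derivative `∂g/∂z_i`. -/
noncomputable def partialDeriv {d : ℕ} (i : Fin d) (g : (Fin d → ℂ) → ℂ) : (Fin d → ℂ) → ℂ :=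
  fun z => fderiv ℂ g z (Pi.single i 1)

/-- The iterated partial derivative `∂^α f = ∂_0^{α_0} ⋯ ∂_{d-1}^{α_{d-1}} f`. -/
noncomputable def mixedPartial {d : ℕ} (α : Fin d →₀ ℕ) (f : (Fin d → ℂ) → ℂ) :
    (Fin d → ℂ) → ℂ :=
  (List.finRange d).foldr (fun i g => (partialDeriv i)^[α i] g) f

/-- The coefficient `(∂^α f)(0) / α!` of the power series expansion of `f` at `0`. -/
noncomputable def taylorCoeff {d : ℕ} (f : (Fin d → ℂ) → ℂ) (α : Fin d →₀ ℕ) : ℂ :=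
  mixedPartial α f 0 / ∏ i, ((α i).factorial : ℂ)

/-- The monomial `T^α = T_0^{α_0} ⋯ T_{d-1}^{α_{d-1}}` of a tuple (used for commuting tuples). -/
def monomial {d : ℕ} {A : Type*} [Monoid A] (T : Fin d → A) (α : Fin d →₀ ℕ) : A :=
  (List.ofFn fun i => T i ^ α i).prod

/-- `p(T)` for a polynomial `p` and a (commuting) tuple `T`. -/
noncomputable def polyEval {d : ℕ} {A : Type*} [Ring A] [Algebra ℂ A] (T : Fin d → A)
    (p : MvPolynomial (Fin d) ℂ) : A :=
  ∑ α ∈ p.support, p.coeff α • monomial T α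

/-- `f(T)`, obtained by plugging `T` into the power series expansion of `f` at `0`.
For `f` holomorphic on the polydisc and `T` a commuting tuple of strict contractions the series
converges absolutely. -/
noncomputable def holoEval {d : ℕ} {A : Type*} [NormedRing A] [NormedAlgebra ℂ A]
    (f : (Fin d → ℂ) → ℂ) (T : Fin d → A) : A :=
  ∑' α : Fin d →₀ ℕ, taylorCoeff f α • monomial T α

/-- The entries commute pairwise and have norm `< 1`. -/
def IsCommutingStrict {d : ℕ} {A : Type*} [NormedRing A] (T : Fin d → A) : Prop :=
  (∀ i j, Commute (T i) (T j)) ∧ ∀ i, ‖T i‖ < 1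

/-- The Schur–Agler norm, with values in `[0, ∞]`: the supremum of `‖f(T)‖` over all commuting
tuples `T` of strict contractions on complex Hilbert spaces. -/
noncomputable def schurAglerNorm {d : ℕ} (f : (Fin d → ℂ) → ℂ) : ℝ≥0∞ :=
  ⨆ (H : Type u) (_ : NormedAddCommGroup H) (_ : InnerProductSpace ℂ H) (_ : CompleteSpace H)
    (T : Fin d → (H →L[ℂ] H)) (_ : IsCommutingStrict T), ‖holoEval f T‖ₑ

/-- There is a vector `ξ` such that the vectors `p(T) ξ`, `p` a polynomial, are dense. -/
def IsCyclic {d n : ℕ} (T : Fin d → Matrix (Fin n) (Fin n) ℂ) : Prop :=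
  ∃ ξ : Fin n → ℂ,
    Dense (Set.range fun p : MvPolynomial (Fin d) ℂ => (polyEval T p).mulVec ξ)

/-- The cyclic commuting `d`-tuples of strictly contractive `n × n` matrices
(the norm is the operator norm on `ℂ^n` with the Euclidean norm). -/
def cyclicTuples (d n : ℕ) : Set (Fin d → Matrix (Fin n) (Fin n) ℂ) :=
  {T | IsCommutingStrict T ∧ IsCyclic T}

/-- All monomials of sufficiently high degree vanish on `T`. -/
def JointlyNilpotent {d n : ℕ} (T : Fin d → Matrix (Fin n) (Fin n) ℂ) : Prop :=
  ∃ N : ℕ, ∀ α : Fin d →₀ ℕ, N ≤ ∑ i, α i → monomial T α = 0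

/-- A single similarity (not necessarily unitary) makes all the matrices diagonal. -/
def JointlyDiagonalizable {d n : ℕ} (T : Fin d → Matrix (Fin n) (Fin n) ℂ) : Prop :=
  ∃ (S : (Matrix (Fin n) (Fin n) ℂ)ˣ) (D : Fin d → Fin n → ℂ),
    ∀ i, T i = S.val * Matrix.diagonal (D i) * S⁻¹.val

end SchurAgler

/-! Matrices act on finite-dimensional Hilbert spaces, so both suprema are at most the Schur–Agler
norm. Conversely, let `c < ‖f(T) ξ‖` with `‖ξ‖ < 1` and `‖T i‖ ≤ r < 1`. Let `S` be the nilpotent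
shift on `ℂ^N`. Applying `f(T ⊗ S)` to `N` copies of `ξ` puts the partial sum `∑_{|α| ≤ j} a_α T^α
ξ` in slot `j`. These sums tend to `f(T) ξ`, so by Cesàro averaging of squared norms `‖f(T ⊗ S)‖ >
c` for a suitable `N`. Adding a direct summand `r S'`, with `S'` the truncated multishift, and a
small component `ε ξ` of the starting vector makes the orbit vectors with `|α| < N` linearly
independent. The cyclic subspace is then `ℂ[z]` modulo degree `≥ N`, with a Hilbert norm in which
each `z_i` acts with norm at most `r` (`exists_model`). This settles the nilpotent case.

For the diagonalizable case, keep that norm and deform `z_i` to `z_i + t D_i`, with `D_i` the degree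
operator. In a Newton basis this is multiplication by the coordinate on functions on the grid `{t
γ}`, so it is diagonalizable for `t ≠ 0` (`gridEval_gridShift`, `gridEval_injective`), while it
commutes and stays cyclic for every `t`. Let `t → 0` and use continuity of `T ↦ f(T)`
(`tendsto_holoEval`), where Cauchy's estimates supply the dominating series. -/

/-! ### Several complex variables: Cauchy's estimates for Taylor coefficients -/

open MeasureTheory Metric in
/-- Directional derivatives of a holomorphic function of several variables are holomorphic. -/
theorem differentiableOn_fderiv_apply {d : ℕ} {U : Set (Fin d → ℂ)} (hU : IsOpen U)
    {g : (Fin d → ℂ) → ℂ} (hg : DifferentiableOn ℂ g U) (v : Fin d → ℂ) :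
    DifferentiableOn ℂ (fun z => fderiv ℂ g z v) U := by
  intro x₀ hx₀
  obtain ⟨R, hR, hRU⟩ : ∃ R > 0, closedBall x₀ (3 * R) ⊆ U := by
    obtain ⟨e, he, h⟩ := Metric.nhds_basis_closedBall.mem_iff.1 (hU.mem_nhds hx₀)
    exact ⟨e / 3, by positivity, by rwa [mul_div_cancel₀ _ (by norm_num)]⟩
  obtain ⟨C, hC⟩ := (isCompact_closedBall x₀ (3 * R)).exists_bound_of_continuousOn
    (hg.continuousOn.mono hRU)
  have hC0 : 0 ≤ C := (norm_nonneg _).trans (hC x₀ (mem_closedBall_self (by positivity)))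
  have hfd : ∀ y ∈ ball x₀ (2 * R), ‖fderiv ℂ g y‖ ≤ (2 * C + 1) / R := by
    intro y hy
    have hsub : ball y R ⊆ closedBall x₀ (3 * R) := fun z hz => by
      rw [mem_ball] at hy hz
      rw [mem_closedBall]
      linarith [dist_triangle z y x₀]
    refine Complex.norm_fderiv_le_div_of_mapsTo_ball (hg.mono (hsub.trans hRU)) ?_ hR
    intro z hz
    rw [mem_closedBall, dist_eq_norm]
    have h1 := norm_sub_le (g z) (g y)
    have h2 := hC z (hsub hz)
    have h3 := hC y (hsub (mem_ball_self hR))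
    linarith
  -- The radius is small enough that the discs `x + ζ v`, `|ζ| ≤ s`, stay in the ball of radius
  -- `2R`; the `+ 1` covers `v = 0`.
  set s : ℝ := R / (‖v‖ + 1) with hs
  have hs0 : 0 < s := by positivity
  have hsv : s * ‖v‖ < R := by
    rw [hs, div_mul_eq_mul_div, div_lt_iff₀ (by positivity)]
    nlinarith [norm_nonneg v]
  have hmem : ∀ x ∈ ball x₀ R, ∀ ζ ∈ closedBall (0 : ℂ) s, x + ζ • v ∈ ball x₀ (2 * R) := by
    intro x hx ζ hζ
    rw [mem_ball, dist_eq_norm] at hx ⊢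
    rw [mem_closedBall_zero_iff] at hζ
    have : ‖x + ζ • v - x₀‖ ≤ ‖x - x₀‖ + ‖ζ‖ * ‖v‖ := by
      rw [← norm_smul, add_sub_right_comm]
      exact norm_add_le _ _
    nlinarith [norm_nonneg v]
  have h2U : ball x₀ (2 * R) ⊆ U :=
    ((ball_subset_ball (by linarith)).trans ball_subset_closedBall).trans hRU
  have hdiff : ∀ y ∈ ball x₀ (2 * R), DifferentiableAt ℂ g y := fun y hy =>
    hg.differentiableAt (hU.mem_nhds (h2U hy))
  set c : ℝ → ℂ := fun θ => deriv (circleMap 0 s) θ * (1 / (circleMap 0 s θ - 0) ^ 2) with hc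
  have hcm : ∀ θ, circleMap 0 s θ ∈ closedBall (0 : ℂ) s := fun θ =>
    sphere_subset_closedBall (circleMap_mem_sphere 0 hs0.le θ)
  have hne : ∀ θ, circleMap 0 s θ - 0 ≠ 0 := fun θ => by
    rw [sub_zero]; exact circleMap_ne_center hs0.ne'
  have hccont : Continuous c := by
    have : Continuous (circleMap 0 s) := continuous_circleMap 0 s
    simp only [hc, deriv_circleMap]
    refine Continuous.mul (by fun_prop) (Continuous.div (by fun_prop) (by fun_prop) fun θ => ?_)
    exact pow_ne_zero _ (hne θ)
  -- Cauchy's formula on the complex line through `x` in direction `v` expresses the derivative by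
  -- values of `g` only, so one may differentiate in `x` under the integral.
  have hformula : ∀ x ∈ ball x₀ R, fderiv ℂ g x v = (2 * Real.pi * Complex.I)⁻¹ *
      ∫ θ in Set.Ioc 0 (2 * Real.pi), c θ * g (x + circleMap 0 s θ • v) := by
    intro x hx
    have hxd : DifferentiableAt ℂ g x := hdiff x (ball_subset_ball (by linarith) hx)
    have hline : ∀ ζ : ℂ, HasDerivAt (fun ζ : ℂ => x + ζ • v) v ζ := fun ζ => by
      simpa using ((hasDerivAt_id ζ).smul_const v).const_add x
    have h1 : deriv (fun ζ : ℂ => g (x + ζ • v)) 0 = fderiv ℂ g x v := by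
      have : HasFDerivAt g (fderiv ℂ g x) (x + (0 : ℂ) • v) := by simpa using hxd.hasFDerivAt
      exact (this.comp_hasDerivAt 0 (hline 0)).deriv
    have h2 : DifferentiableOn ℂ (fun ζ : ℂ => g (x + ζ • v)) (closedBall 0 s) := fun ζ hζ =>
      ((hdiff _ (hmem x hx ζ hζ)).comp ζ (hline ζ).differentiableAt).differentiableWithinAt
    have h3 := h2.deriv_eq_smul_circleIntegral hs0
    rw [h1, circleIntegral, intervalIntegral.integral_of_le (by positivity)] at h3
    rw [eq_inv_mul_iff_mul_eq₀ Complex.two_pi_I_ne_zero, ← smul_eq_mul, ← h3]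
    simp only [hc, smul_eq_mul, mul_assoc]
  have hcontF : ∀ x ∈ ball x₀ R, Continuous fun θ => c θ * g (x + circleMap 0 s θ • v) := by
    intro x hx
    refine hccont.mul ?_
    have : ContinuousOn g (ball x₀ (2 * R)) := hg.continuousOn.mono h2U
    refine this.comp_continuous ?_ fun θ => hmem x hx _ (hcm θ)
    have : Continuous (circleMap 0 s) := continuous_circleMap 0 s
    fun_prop
  have hint : ∀ x ∈ ball x₀ R, IntegrableOn (fun θ => c θ * g (x + circleMap 0 s θ • v))
      (Set.Ioc 0 (2 * Real.pi)) := fun x hx =>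
    ((hcontF x hx).intervalIntegrable 0 (2 * Real.pi)).1
  have key := hasFDerivAt_integral_of_dominated_of_fderiv_le (𝕜 := ℂ)
    (μ := volume.restrict (Set.Ioc 0 (2 * Real.pi)))
    (F := fun x θ => c θ * g (x + circleMap 0 s θ • v))
    (F' := fun x θ => c θ • fderiv ℂ g (x + circleMap 0 s θ • v))
    (x₀ := x₀) (s := ball x₀ R) (bound := fun θ => ‖c θ‖ * ((2 * C + 1) / R))
    (ball_mem_nhds x₀ hR)
    (Filter.eventually_of_mem (ball_mem_nhds x₀ hR) fun x hx =>
      (hcontF x hx).aestronglyMeasurable)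
    (hint x₀ (mem_ball_self hR))
    (by
      refine hccont.aestronglyMeasurable.smul ?_
      have : Continuous (circleMap 0 s) := continuous_circleMap 0 s
      -- Continuity of `fderiv ℂ g` is not yet known; measurability suffices.
      exact ((measurable_fderiv ℂ g).comp
        (by fun_prop : Continuous fun θ => x₀ + circleMap 0 s θ • v).measurable).aestronglyMeasurable)
    (Filter.Eventually.of_forall fun θ x hx => by
      rw [norm_smul]
      exact mul_le_mul_of_nonneg_left (hfd _ (hmem x hx _ (hcm θ))) (norm_nonneg _))
    (((hccont.norm.mul continuous_const).intervalIntegrable 0 (2 * Real.pi)).1)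
    (Filter.Eventually.of_forall fun θ x hx => by
      have h1 := (hdiff _ (hmem x hx _ (hcm θ))).hasFDerivAt
      have h2 : HasFDerivAt (fun x : Fin d → ℂ => x + circleMap 0 s θ • v)
        (ContinuousLinearMap.id ℂ _) x := (hasFDerivAt_id x).add_const _
      simpa using (h1.comp x h2).const_mul (c θ))
  refine (DifferentiableAt.congr_of_eventuallyEq
    (key.differentiableAt.const_mul (2 * Real.pi * Complex.I)⁻¹) ?_).differentiableWithinAt
  exact Filter.eventually_of_mem (ball_mem_nhds x₀ hR) hformula

namespace SchurAgler

theorem isOpen_polydisc (d : ℕ) : IsOpen (polydisc d) := by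
  simp only [polydisc, Set.ofPred_forall]
  exact isOpen_iInter_of_finite fun i => isOpen_lt (by fun_prop) continuous_const

theorem differentiableOn_partialDeriv_iterate {d : ℕ} {g : (Fin d → ℂ) → ℂ}
    (hg : DifferentiableOn ℂ g (polydisc d)) (i : Fin d) (k : ℕ) :
    DifferentiableOn ℂ ((partialDeriv i)^[k] g) (polydisc d) := by
  induction k with
  | zero => exact hg
  | succ k ih =>
    rw [Function.iterate_succ_apply']
    exact differentiableOn_fderiv_apply (isOpen_polydisc d) ih _

theorem update_mem_polydisc {d : ℕ} {z : Fin d → ℂ} (hz : z ∈ polydisc d) (i : Fin d) {ζ : ℂ}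
    (hζ : ‖ζ‖ < 1) : Function.update z i ζ ∈ polydisc d := fun j => by
  rcases eq_or_ne j i with rfl | h
  · simpa using hζ
  · simpa [h] using hz j

theorem iteratedDeriv_update_eq {d : ℕ} {g : (Fin d → ℂ) → ℂ}
    (hg : DifferentiableOn ℂ g (polydisc d)) (i : Fin d) (k : ℕ) {z : Fin d → ℂ}
    (hz : z ∈ polydisc d) : ∀ ζ ∈ Metric.ball (0 : ℂ) 1,
    iteratedDeriv k (fun ζ => g (Function.update z i ζ)) ζ =
      (partialDeriv i)^[k] g (Function.update z i ζ) := by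
  induction k with
  | zero => simp
  | succ k ih =>
    intro ζ hζ
    rw [iteratedDeriv_succ, Function.iterate_succ_apply']
    have h1 : iteratedDeriv k (fun ζ => g (Function.update z i ζ)) =ᶠ[nhds ζ]
        fun ζ => (partialDeriv i)^[k] g (Function.update z i ζ) :=
      Filter.eventually_of_mem (Metric.isOpen_ball.mem_nhds hζ) ih
    rw [h1.deriv_eq]
    have h2 := (differentiableOn_partialDeriv_iterate hg i k).differentiableAt
      ((isOpen_polydisc d).mem_nhds (update_mem_polydisc hz i (mem_ball_zero_iff.1 hζ)))
    exact (h2.hasFDerivAt.comp_hasDerivAt ζ (hasDerivAt_update z i ζ)).deriv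

/-- The one-variable Cauchy estimate on the slice in direction `i`, centred at `z` because `z i =
0`: use circles of radius `s < 1`, then let `s → 1`. -/
theorem norm_partialDeriv_iterate_le {d : ℕ} {g : (Fin d → ℂ) → ℂ}
    (hg : DifferentiableOn ℂ g (polydisc d)) (i : Fin d) (k : ℕ) {C : ℝ} {z : Fin d → ℂ}
    (hz : z ∈ polydisc d) (hzi : z i = 0)
    (hC : ∀ ζ : ℂ, ‖ζ‖ < 1 → ‖g (Function.update z i ζ)‖ ≤ C) :
    ‖(partialDeriv i)^[k] g z‖ ≤ k.factorial * C := by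
  have hz0 : Function.update z i 0 = z := by rw [← hzi, Function.update_eq_self]
  have hlim : Filter.Tendsto (fun s : ℝ => k.factorial * C / s ^ k) (nhdsWithin 1 (Set.Iio 1))
      (nhds (k.factorial * C / 1 ^ k)) := by
    have : ContinuousAt (fun s : ℝ => k.factorial * C / s ^ k) 1 := by
      apply ContinuousAt.div <;> first | fun_prop | simp
    exact this.tendsto.mono_left nhdsWithin_le_nhds
  rw [one_pow, div_one] at hlim
  refine ge_of_tendsto hlim ?_
  filter_upwards [Ioo_mem_nhdsLT (zero_lt_one (α := ℝ))] with s hs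
  have h := Complex.norm_iteratedDeriv_le_of_forall_mem_sphere_norm_le (c := 0) (R := s) (C := C)
    (f := fun ζ => g (Function.update z i ζ)) k hs.1 ?_ ?_
  · rwa [iteratedDeriv_update_eq hg i k hz 0 (by simp), hz0] at h
  · refine DifferentiableOn.diffContOnCl_ball (U := Metric.ball 0 1) ?_
      (Metric.closedBall_subset_ball hs.2)
    intro ζ hζ
    have h2 := hg.differentiableAt
      ((isOpen_polydisc d).mem_nhds (update_mem_polydisc hz i (mem_ball_zero_iff.1 hζ)))
    exact (h2.hasFDerivAt.comp_hasDerivAt ζ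
      (hasDerivAt_update z i ζ)).differentiableAt.differentiableWithinAt
  · intro ζ hζ
    exact hC ζ (by rw [mem_sphere_zero_iff_norm.1 hζ]; exact hs.2)

/-- One variable is treated at a time. Since the list has no duplicates, moving coordinate `i` keeps
the remaining listed coordinates at `0`, so the inductive bound holds on the whole slice. -/
theorem norm_foldr_partialDeriv_le {d : ℕ} {f : (Fin d → ℂ) → ℂ} {C : ℝ}
    (hf : DifferentiableOn ℂ f (polydisc d)) (hC : ∀ z ∈ polydisc d, ‖f z‖ ≤ C)
    (α : Fin d →₀ ℕ) (l : List (Fin d)) (hl : l.Nodup) :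
    DifferentiableOn ℂ (l.foldr (fun i g => (partialDeriv i)^[α i] g) f) (polydisc d) ∧
    ∀ z ∈ polydisc d, (∀ i ∈ l, z i = 0) →
      ‖l.foldr (fun i g => (partialDeriv i)^[α i] g) f z‖ ≤
        (l.map fun i => ((α i).factorial : ℝ)).prod * C := by
  induction l with
  | nil => exact ⟨hf, fun z hz _ => by simpa using hC z hz⟩
  | cons i l ih =>
    obtain ⟨hil, hl⟩ := List.nodup_cons.1 hl
    obtain ⟨hd, hb⟩ := ih hl
    refine ⟨differentiableOn_partialDeriv_iterate hd i _, fun z hz h0 => ?_⟩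
    rw [List.map_cons, List.prod_cons, mul_assoc]
    refine norm_partialDeriv_iterate_le hd i _ hz (h0 i (by simp)) fun ζ hζ => ?_
    refine hb _ (update_mem_polydisc hz i hζ) fun j hj => ?_
    rw [Function.update_of_ne (by rintro rfl; exact hil hj)]
    exact h0 j (by simp [hj])

/-- Cauchy's estimates on the polydisc. -/
theorem IsHInfty.exists_norm_taylorCoeff_le {d : ℕ} {f : (Fin d → ℂ) → ℂ} (hf : IsHInfty f) :
    ∃ C : ℝ, ∀ α, ‖taylorCoeff f α‖ ≤ C := by
  obtain ⟨hd, C, hC⟩ := hf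
  refine ⟨C, fun α => ?_⟩
  have h := (norm_foldr_partialDeriv_le hd hC α _ (List.nodup_finRange d)).2 0
    (fun i => by simp) (fun i _ => rfl)
  rw [← List.ofFn_eq_map, List.prod_ofFn] at h
  have hpos : 0 < ∏ i, ((α i).factorial : ℝ) :=
    Finset.prod_pos fun i _ => by exact_mod_cast Nat.factorial_pos _
  have hn : ‖∏ i, ((α i).factorial : ℂ)‖ = ∏ i, ((α i).factorial : ℝ) := by simp
  rw [taylorCoeff, norm_div, hn, div_le_iff₀ hpos, mul_comm C]
  exact h

/-! ### Monomials in commuting tuples and the functional calculus -/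

open Finsupp (single)

theorem degree_eq_sum_univ {d : ℕ} (α : Fin d →₀ ℕ) : α.degree = ∑ i, α i :=
  Finsupp.degree_eq_sum α

theorem multiindex_induction {d : ℕ} {p : (Fin d →₀ ℕ) → Prop} (h0 : p 0)
    (hs : ∀ α i, p α → p (α + single i 1)) (α : Fin d →₀ ℕ) : p α := by
  induction hn : α.degree generalizing α with
  | zero => rwa [(Finsupp.degree_eq_zero_iff α).1 hn]
  | succ n ih =>
    obtain ⟨i, hi⟩ : ∃ i, α i ≠ 0 := by
      by_contra! h
      rw [Finsupp.ext (g := 0) h] at hn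
      simp at hn
    have hα : α - single i 1 + single i 1 = α :=
      tsub_add_cancel_of_le (Finsupp.single_le_iff.2 (Nat.one_le_iff_ne_zero.2 hi))
    rw [← hα]
    refine hs _ _ (ih _ ?_)
    rw [← hα, map_add, Finsupp.degree_single] at hn
    exact Nat.succ_injective hn

theorem map_monomial {d : ℕ} {A B F : Type*} [Monoid A] [Monoid B] [FunLike F A B]
    [MonoidHomClass F A B] (φ : F) (T : Fin d → A) (α : Fin d →₀ ℕ) :
    φ (monomial T α) = monomial (fun i => φ (T i)) α := by
  simp [monomial, map_list_prod, List.map_ofFn, Function.comp_def]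

theorem monomial_add_single_of_commMonoid {d : ℕ} {A : Type*} [CommMonoid A] (T : Fin d → A)
    (α : Fin d →₀ ℕ) (i : Fin d) : monomial T (α + single i 1) = T i * monomial T α := by
  rw [monomial, monomial, List.prod_ofFn, List.prod_ofFn]
  simp only [Finsupp.add_apply, pow_add, Finset.prod_mul_distrib]
  rw [mul_comm, Finset.prod_eq_single i] <;> simp +contextual [eq_comm]

theorem monomial_zero {d : ℕ} {A : Type*} [Monoid A] (T : Fin d → A) : monomial T 0 = 1 := by
  simp [monomial]

/-- The entries generate a commutative submonoid, where the ordered product may be rearranged. -/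
theorem monomial_add_single {d : ℕ} {A : Type*} [Monoid A] {T : Fin d → A}
    (hT : ∀ i j, Commute (T i) (T j)) (α : Fin d →₀ ℕ) (i : Fin d) :
    monomial T (α + single i 1) = T i * monomial T α := by
  have hS := Submonoid.isMulCommutative_closure A (s := Set.range T) (by
    rintro _ ⟨i, rfl⟩ _ ⟨j, rfl⟩; exact hT i j)
  let : CommMonoid (Submonoid.closure (Set.range T)) :=
    { (inferInstance : Monoid (Submonoid.closure (Set.range T))) with
      mul_comm := hS.is_comm.comm }
  let T' : Fin d → Submonoid.closure (Set.range T) := fun i =>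
    ⟨T i, Submonoid.subset_closure ⟨i, rfl⟩⟩
  have h : ∀ β, monomial T β = (Submonoid.closure (Set.range T)).subtype (monomial T' β) :=
    fun β => (map_monomial (Submonoid.closure (Set.range T)).subtype T' β).symm
  have h2 : monomial T' (α + single i 1) = T' i * monomial T' α :=
    monomial_add_single_of_commMonoid T' α i
  rw [h, h, h2, map_mul]
  rfl

theorem norm_monomial_le {d : ℕ} {A : Type*} [NormedRing A] (h1 : ‖(1 : A)‖ ≤ 1) {T : Fin d → A}
    (hT : ∀ i j, Commute (T i) (T j)) {r : ℝ} (hr : 0 ≤ r) (hTr : ∀ i, ‖T i‖ ≤ r)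
    (α : Fin d →₀ ℕ) : ‖monomial T α‖ ≤ r ^ α.degree := by
  induction α using multiindex_induction with
  | h0 => simpa [monomial_zero] using h1
  | hs α i ih =>
    rw [monomial_add_single hT, map_add, Finsupp.degree_single, pow_succ']
    exact (norm_mul_le _ _).trans (mul_le_mul (hTr i) ih (norm_nonneg _) hr)

/-- Any finite set of multi-indices lies in a cube, over which the sum factors into `d` truncated
geometric series. -/
theorem summable_pow_degree (d : ℕ) {r : ℝ} (hr : 0 ≤ r) (hr1 : r < 1) :
    Summable fun α : Fin d →₀ ℕ => r ^ α.degree := by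
  classical
  refine summable_of_sum_le (c := ((1 - r)⁻¹) ^ d) (fun α => by positivity) fun s => ?_
  obtain ⟨K, hK⟩ : ∃ K, ∀ α ∈ s, α.degree < K :=
    ⟨s.sup (fun α => α.degree) + 1, fun α hα =>
      Nat.lt_succ_of_le (Finset.le_sup (f := fun α : Fin d →₀ ℕ => α.degree) hα)⟩
  calc ∑ α ∈ s, r ^ α.degree
      = ∑ x ∈ s.map Finsupp.equivFunOnFinite.toEmbedding, ∏ i, r ^ x i := by
        rw [Finset.sum_map]
        exact Finset.sum_congr rfl fun α _ => by
          rw [degree_eq_sum_univ, Finset.prod_pow_eq_pow_sum]; rfl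
    _ ≤ ∑ x ∈ Fintype.piFinset fun _ : Fin d => Finset.range K, ∏ i, r ^ x i := by
        refine Finset.sum_le_sum_of_subset_of_nonneg (fun x hx => ?_) fun x _ _ => by positivity
        obtain ⟨α, hα, rfl⟩ := Finset.mem_map.1 hx
        rw [Fintype.mem_piFinset]
        intro i
        exact Finset.mem_range.2 ((Finsupp.le_degree i α).trans_lt (hK α hα))
    _ = ∏ _i : Fin d, ∑ k ∈ Finset.range K, r ^ k := by rw [Finset.prod_univ_sum]
    _ ≤ ∏ _i : Fin d, (1 - r)⁻¹ := by
        refine Finset.prod_le_prod (fun _ _ => by positivity) fun _ _ => ?_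
        rw [← tsum_geometric_of_lt_one hr hr1]
        exact (summable_geometric_of_lt_one hr hr1).sum_le_tsum _ fun _ _ => by positivity
    _ = ((1 - r)⁻¹) ^ d := by simp

theorem summable_holoEval {d : ℕ} {A : Type*} [NormedRing A] [NormedAlgebra ℂ A] [CompleteSpace A]
    (h1 : ‖(1 : A)‖ ≤ 1) {f : (Fin d → ℂ) → ℂ} {C : ℝ} (hC : ∀ α, ‖taylorCoeff f α‖ ≤ C)
    {T : Fin d → A} (hT : ∀ i j, Commute (T i) (T j)) {r : ℝ} (hr : 0 ≤ r) (hr1 : r < 1)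
    (hTr : ∀ i, ‖T i‖ ≤ r) : Summable fun α => taylorCoeff f α • monomial T α := by
  refine Summable.of_norm_bounded ((summable_pow_degree d hr hr1).mul_left C) fun α => ?_
  rw [norm_smul]
  exact mul_le_mul (hC α) (norm_monomial_le h1 hT hr hTr α) (norm_nonneg _)
    ((norm_nonneg _).trans (hC α))

/-- Dominated convergence: a single `r < 1` bounds all the tuples near the limit. -/
theorem tendsto_holoEval {d : ℕ} {A X : Type*} [NormedRing A] [NormedAlgebra ℂ A] [CompleteSpace A]
    (h1 : ‖(1 : A)‖ ≤ 1) {f : (Fin d → ℂ) → ℂ} {C : ℝ} (hC : ∀ α, ‖taylorCoeff f α‖ ≤ C)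
    {l : Filter X} {T : X → Fin d → A} {T₀ : Fin d → A} (hT : ∀ x i j, Commute (T x i) (T x j))
    (hlim : Filter.Tendsto T l (nhds T₀)) (hT₀ : ∀ i, ‖T₀ i‖ < 1) :
    Filter.Tendsto (fun x => holoEval f (T x)) l (nhds (holoEval f T₀)) := by
  obtain ⟨r, hr, hr1, hTr⟩ : ∃ r : ℝ, 0 ≤ r ∧ r < 1 ∧ ∀ i, ‖T₀ i‖ < r := by
    obtain ⟨r, hr1, hr⟩ := exists_between ((pi_norm_lt_iff one_pos).2 hT₀)
    exact ⟨r, (norm_nonneg _).trans hr1.le, hr, fun i => (norm_le_pi_norm T₀ i).trans_lt hr1⟩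
  have hev : ∀ᶠ x in l, ∀ i, ‖T x i‖ < r := by
    rw [Filter.eventually_all]
    exact fun i => (((tendsto_pi_nhds.1 hlim) i).norm).eventually_lt_const (hTr i)
  refine tendsto_tsum_of_dominated_convergence ((summable_pow_degree d hr hr1).mul_left C) ?_ ?_
  · intro α
    refine Filter.Tendsto.const_smul ?_ _
    have : Continuous fun S : Fin d → A => monomial S α := by
      simp only [monomial, List.ofFn_eq_map]
      exact continuous_list_prod _ fun i _ => (continuous_apply i).pow _
    exact (this.tendsto T₀).comp hlim
  · filter_upwards [hev] with x hx α
    rw [norm_smul]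
    exact mul_le_mul (hC α) (norm_monomial_le h1 (hT x) hr (fun i => (hx i).le) α) (norm_nonneg _)
      ((norm_nonneg _).trans (hC α))

theorem map_holoEval {d : ℕ} {A B : Type*} [NormedRing A] [NormedAlgebra ℂ A]
    [NormedRing B] [NormedAlgebra ℂ B] (φ : A ≃ₐ[ℂ] B) (hφ : ∀ x, ‖φ x‖ = ‖x‖)
    (f : (Fin d → ℂ) → ℂ) (T : Fin d → A) :
    φ (holoEval f T) = holoEval f (fun i => φ (T i)) := by
  let e : A ≃ₗᵢ[ℂ] B := ⟨φ.toLinearEquiv, hφ⟩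
  -- A continuous linear equivalence commutes with `tsum` even without summability.
  have := e.toContinuousLinearEquiv.map_tsum (L := .unconditional _)
    (f := fun α => taylorCoeff f α • monomial T α)
  simp only [map_smul] at this
  refine this.trans (tsum_congr fun α => ?_)
  congr 1
  exact map_monomial φ T α

/-- `ULift` moves Euclidean space into the universe over which the supremum runs. -/
theorem enorm_holoEval_le_schurAglerNorm {d n : ℕ} (f : (Fin d → ℂ) → ℂ)
    {T : Fin d → Matrix (Fin n) (Fin n) ℂ} (hT : IsCommutingStrict T) :
    ‖holoEval f T‖ₑ ≤ schurAglerNorm.{u} f := by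
  let e : EuclideanSpace ℂ (Fin n) ≃ₗᵢ[ℂ] EuclideanSpace ℂ (ULift.{u} (Fin n)) :=
    LinearIsometryEquiv.piLpCongrLeft 2 ℂ ℂ Equiv.ulift.symm
  let φ : Matrix (Fin n) (Fin n) ℂ ≃ₐ[ℂ] (EuclideanSpace ℂ (ULift.{u} (Fin n)) →L[ℂ]
      EuclideanSpace ℂ (ULift.{u} (Fin n))) :=
    AlgEquiv.trans (Matrix.toEuclideanCLM (𝕜 := ℂ) (n := Fin n)).toAlgEquiv
      e.toContinuousLinearEquiv.conjContinuousAlgEquiv.toAlgEquiv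
  have hφ : ∀ x, ‖φ x‖ = ‖x‖ := fun x => by
    have h1 : φ x = (e.toLinearIsometry.toContinuousLinearMap.comp
        (Matrix.toEuclideanCLM (𝕜 := ℂ) x)).comp
        e.symm.toContinuousLinearEquiv.toContinuousLinearMap := rfl
    rw [h1, ContinuousLinearMap.opNorm_comp_linearIsometryEquiv,
      LinearIsometry.norm_toContinuousLinearMap_comp, Matrix.cstar_norm_def]
  have h : ‖holoEval f T‖ₑ = ‖holoEval f fun i => φ (T i)‖ₑ := by
    rw [← map_holoEval φ hφ f T, ← ofReal_norm, ← ofReal_norm, hφ]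
  rw [h]
  have hT' : IsCommutingStrict fun i => φ (T i) :=
    ⟨fun i j => (hT.1 i j).map φ, fun i => by rw [hφ]; exact hT.2 i⟩
  exact le_iSup_of_le (EuclideanSpace ℂ (ULift.{u} (Fin n))) <| le_iSup_of_le _ <|
    le_iSup_of_le _ <| le_iSup_of_le _ <| le_iSup_of_le _ <|
    le_iSup (fun _ : IsCommutingStrict fun i => φ (T i) => ‖holoEval f fun i => φ (T i)‖ₑ) hT'

/-! ### Truncated polynomials, and their deformation to functions on a grid -/

/-- The multi-indices of degree less than `N`. -/
abbrev MultiIndex (d N : ℕ) : Type := {α : Fin d →₀ ℕ // α.degree < N}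

noncomputable instance (d N : ℕ) : Fintype (MultiIndex d N) :=
  have : Finite (MultiIndex d N) :=
    ((Finsupp.finite_of_degree_le N).subset fun α (h : α.degree < N) => h.le).to_subtype
  Fintype.ofFinite _

/-- The truncated monomial `z^α`: a basis vector if `|α| < N`, and zero otherwise. -/
noncomputable def truncMonomial {d : ℕ} (N : ℕ) (α : Fin d →₀ ℕ) : MultiIndex d N → ℂ :=
  if h : α.degree < N then Pi.single ⟨α, h⟩ 1 else 0

theorem basisFun_eq_truncMonomial {d N : ℕ} (β : MultiIndex d N) :
    Pi.basisFun ℂ (MultiIndex d N) β = truncMonomial N β.1 := by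
  simp [truncMonomial, β.2]

theorem linearMap_ext_truncMonomial {d N : ℕ} {V : Type*} [AddCommMonoid V] [Module ℂ V]
    {X Y : (MultiIndex d N → ℂ) →ₗ[ℂ] V}
    (h : ∀ α, X (truncMonomial N α) = Y (truncMonomial N α)) : X = Y :=
  (Pi.basisFun ℂ (MultiIndex d N)).ext fun β => by rw [basisFun_eq_truncMonomial, h]

/-- The linear map with prescribed values on the truncated monomials. -/
noncomputable def truncLift {d : ℕ} (N : ℕ) {V : Type*} [AddCommMonoid V] [Module ℂ V]
    (k : (Fin d →₀ ℕ) → V) : (MultiIndex d N → ℂ) →ₗ[ℂ] V :=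
  (Pi.basisFun ℂ (MultiIndex d N)).constr ℂ fun β => k β.1

/-- Letting `k` live on all multi-indices, and vanish from degree `N` on, spares later formulas a
case split at the cutoff. -/
theorem truncLift_truncMonomial {d N : ℕ} {V : Type*} [AddCommMonoid V] [Module ℂ V]
    {k : (Fin d →₀ ℕ) → V} (hk : ∀ α, N ≤ α.degree → k α = 0) (α : Fin d →₀ ℕ) :
    truncLift N k (truncMonomial N α) = k α := by
  by_cases h : α.degree < N
  · rw [← basisFun_eq_truncMonomial ⟨α, h⟩, truncLift, Module.Basis.constr_basis]
  · rw [truncMonomial, dif_neg h, map_zero, hk α (not_lt.1 h)]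

theorem truncLift_apply {d N : ℕ} {V : Type*} [AddCommMonoid V] [Module ℂ V]
    (k : (Fin d →₀ ℕ) → V) (v : MultiIndex d N → ℂ) :
    truncLift N k v = ∑ β, v β • k β.1 := by
  simp [truncLift, Module.Basis.constr_apply_fintype]

theorem truncMonomial_of_le {d N : ℕ} {α : Fin d →₀ ℕ} (h : N ≤ α.degree) :
    truncMonomial N α = 0 := dif_neg (not_lt.2 h)

/-- Truncated multiplication by `z_i`. -/
noncomputable def truncShift {d : ℕ} (N : ℕ) (i : Fin d) : Module.End ℂ (MultiIndex d N → ℂ) :=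
  truncLift N fun α => truncMonomial N (α + single i 1)

/-- The degree operator in the variable `z_i`. -/
noncomputable def truncDegree {d : ℕ} (N : ℕ) (i : Fin d) : Module.End ℂ (MultiIndex d N → ℂ) :=
  truncLift N fun α => (α i : ℂ) • truncMonomial N α

theorem truncShift_apply {d : ℕ} (N : ℕ) (i : Fin d) (α : Fin d →₀ ℕ) :
    truncShift N i (truncMonomial N α) = truncMonomial N (α + single i 1) :=
  truncLift_truncMonomial (fun α h => truncMonomial_of_le (by simp; omega)) α

theorem truncDegree_apply {d : ℕ} (N : ℕ) (i : Fin d) (α : Fin d →₀ ℕ) :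
    truncDegree N i (truncMonomial N α) = (α i : ℂ) • truncMonomial N α :=
  truncLift_truncMonomial (fun α h => by rw [truncMonomial_of_le h, smul_zero]) α

/-- The deformation of the truncated multiplication operators: in the Newton basis of products
`∏ i, ∏ j < α i, (z_i - t * j)`, this is multiplication by `z_i` on functions on a grid. -/
noncomputable def gridShift {d : ℕ} (N : ℕ) (t : ℂ) (i : Fin d) :
    Module.End ℂ (MultiIndex d N → ℂ) :=
  truncShift N i + t • truncDegree N i

theorem gridShift_zero {d : ℕ} (N : ℕ) (i : Fin d) : gridShift N 0 i = truncShift N i := by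
  simp [gridShift]

theorem gridShift_apply {d : ℕ} (N : ℕ) (t : ℂ) (i : Fin d) (α : Fin d →₀ ℕ) :
    gridShift N t i (truncMonomial N α) =
      truncMonomial N (α + single i 1) + (t * α i) • truncMonomial N α := by
  simp [gridShift, truncShift_apply, truncDegree_apply, smul_smul]

theorem gridShift_commute {d : ℕ} (N : ℕ) (t : ℂ) (i j : Fin d) :
    Commute (gridShift N t i) (gridShift N t j) := by
  rcases eq_or_ne i j with rfl | hij
  · exact Commute.refl _
  refine linearMap_ext_truncMonomial fun α => ?_
  simp only [Module.End.mul_apply, gridShift_apply, map_add, map_smul, smul_add, smul_smul,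
    Finsupp.add_apply, Finsupp.single_eq_of_ne hij, Finsupp.single_eq_of_ne hij.symm, add_zero,
    add_right_comm α (single j 1) (single i 1)]
  rw [mul_comm (t * (α i : ℂ))]
  abel

theorem monomial_truncShift_apply {d : ℕ} (N : ℕ) (α β : Fin d →₀ ℕ) :
    monomial (truncShift N) α (truncMonomial N β) = truncMonomial N (α + β) := by
  have hcomm : ∀ i j, Commute (truncShift (d := d) N i) (truncShift N j) := fun i j => by
    simpa [gridShift_zero] using gridShift_commute N 0 i j
  induction α using multiindex_induction with
  | h0 => simp [monomial_zero]
  | hs α i ih =>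
    rw [monomial_add_single hcomm, Module.End.mul_apply, ih, truncShift_apply]
    congr 1
    abel

theorem monomial_truncShift_eq_zero {d N : ℕ} {α : Fin d →₀ ℕ} (h : N ≤ α.degree) :
    monomial (truncShift N) α = 0 :=
  linearMap_ext_truncMonomial fun β => by
    rw [monomial_truncShift_apply, truncMonomial_of_le (by simp; omega), LinearMap.zero_apply]

/-- The deformation is triangular: `z^(α + e_i)` is the image of `z^α` minus a multiple of `z^α`.
Hence `1` remains cyclic for every `t`. -/
theorem eq_top_of_gridShift_invariant {d : ℕ} (N : ℕ) (t : ℂ)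
    (W : Submodule ℂ (MultiIndex d N → ℂ)) (h0 : truncMonomial N 0 ∈ W)
    (hW : ∀ i, ∀ v ∈ W, gridShift N t i v ∈ W) : W = ⊤ := by
  have h : ∀ α, truncMonomial N α ∈ W := fun α => by
    induction α using multiindex_induction with
    | h0 => exact h0
    | hs α i ih =>
      have := W.sub_mem (hW i _ ih) (W.smul_mem (t * α i) ih)
      rwa [gridShift_apply, add_sub_cancel_right] at this
  rw [eq_top_iff, ← (Pi.basisFun ℂ (MultiIndex d N)).span_eq, Submodule.span_le]
  rintro _ ⟨β, rfl⟩
  rw [basisFun_eq_truncMonomial]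
  exact h _

/-- Evaluation on the grid `{t γ : |γ| < N}` of a polynomial given in the Newton basis. -/
noncomputable def gridEval (d N : ℕ) (t : ℂ) : Module.End ℂ (MultiIndex d N → ℂ) :=
  truncLift N fun α γ => t ^ α.degree * ∏ i, ((γ.1 i).descFactorial (α i) : ℂ)

theorem eq_of_le_of_degree_le {d : ℕ} {α γ : Fin d →₀ ℕ} (h : α ≤ γ) (hd : γ.degree ≤ α.degree) :
    α = γ := by
  have h1 : γ - α + α = γ := tsub_add_cancel_of_le h
  have h2 := congrArg Finsupp.degree h1
  rw [map_add] at h2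
  have h3 : γ - α = 0 := (Finsupp.degree_eq_zero_iff _).1 (by omega)
  rw [← h1, h3, zero_add]

theorem prod_descFactorial_eq_zero {d : ℕ} {α γ : Fin d →₀ ℕ} (h : ¬ α ≤ γ) :
    ∏ i, ((γ i).descFactorial (α i) : ℂ) = 0 := by
  obtain ⟨i, hi⟩ : ∃ i, γ i < α i := by simpa [Finsupp.le_def] using h
  exact Finset.prod_eq_zero (Finset.mem_univ i)
    (by rw [Nat.descFactorial_eq_zero_iff_lt.2 hi, Nat.cast_zero])

/-- The right side is the Newton polynomial of index `α` at `t γ`. For `|α| ≥ N` it vanishes on the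
grid, as `α ≤ γ` is impossible; so truncation loses nothing. -/
theorem gridEval_truncMonomial {d : ℕ} (N : ℕ) (t : ℂ) (α : Fin d →₀ ℕ) (γ : MultiIndex d N) :
    gridEval d N t (truncMonomial N α) γ =
      t ^ α.degree * ∏ i, ((γ.1 i).descFactorial (α i) : ℂ) := by
  rw [gridEval, truncLift_truncMonomial]
  intro α hα
  funext γ
  rw [prod_descFactorial_eq_zero, mul_zero, Pi.zero_apply]
  intro h
  have := Finsupp.degree_mono h
  have := γ.2
  omega

/-- The Newton recursion `z_i p_α = p_(α + e_i) + t α_i p_α`, read at the grid point `t γ`. -/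
theorem gridEval_gridShift {d : ℕ} (N : ℕ) (t : ℂ) (i : Fin d) (v : MultiIndex d N → ℂ)
    (γ : MultiIndex d N) :
    gridEval d N t (gridShift N t i v) γ = t * γ.1 i * gridEval d N t v γ := by
  suffices h : LinearMap.proj γ ∘ₗ gridEval d N t ∘ₗ gridShift N t i =
      (t * γ.1 i) • (LinearMap.proj γ ∘ₗ gridEval d N t) by
    exact LinearMap.congr_fun h v
  refine linearMap_ext_truncMonomial fun α => ?_
  simp only [LinearMap.comp_apply, LinearMap.smul_apply, LinearMap.proj_apply, gridShift_apply,
    map_add, map_smul, smul_eq_mul, gridEval_truncMonomial,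
    Finsupp.degree_single]
  have h : ∏ j, ((γ.1 j).descFactorial ((α + single i 1 : Fin d →₀ ℕ) j) : ℂ) =
      ((γ.1 i : ℂ) - α i) * ∏ j, ((γ.1 j).descFactorial (α j) : ℂ) := by
    rw [← Finset.mul_prod_erase _ _ (Finset.mem_univ i),
      ← Finset.mul_prod_erase Finset.univ (fun j => ((γ.1 j).descFactorial (α j) : ℂ))
        (Finset.mem_univ i), ← mul_assoc]
    congr 1
    · rw [Finsupp.add_apply, Finsupp.single_eq_same, Nat.descFactorial_succ, Nat.cast_mul]
      -- For `α i > γ i` the natural subtraction is wrong, but the falling factorial beside it is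
      -- zero.
      rcases le_or_gt (α i) (γ.1 i) with h | h
      · rw [Nat.cast_sub h]
      · simp [Nat.descFactorial_eq_zero_iff_lt.2 h]
    · refine Finset.prod_congr rfl fun j hj => ?_
      rw [Finsupp.add_apply, Finsupp.single_eq_of_ne (Finset.ne_of_mem_erase hj), add_zero]
  rw [h, pow_succ]
  ring

/-- Triangularity: `p_β(t γ) = 0` unless `β ≤ γ`, and the diagonal entry `t^|γ| γ!` is nonzero. -/
theorem gridEval_injective (d N : ℕ) {t : ℂ} (ht : t ≠ 0) :
    Function.Injective (gridEval d N t) := by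
  rw [injective_iff_map_eq_zero]
  intro v hv
  have hsum : ∀ γ : MultiIndex d N, ∑ β, v β * (t ^ β.1.degree * ∏ i, ((γ.1 i).descFactorial (β.1 i) : ℂ)) = 0 := by
    intro γ
    have := congrFun hv γ
    rwa [gridEval, truncLift_apply, Finset.sum_apply] at this
  funext γ
  induction hn : γ.1.degree using Nat.strong_induction_on generalizing γ with
  | _ n ih =>
    have h := hsum γ
    rw [Finset.sum_eq_single γ] at h
    · simp only [Nat.descFactorial_self, mul_eq_zero, pow_eq_zero_iff', ht, false_and,
        Finset.prod_eq_zero_iff, Nat.cast_eq_zero, Nat.factorial_ne_zero, and_false,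
        exists_false, or_false] at h
      exact h
    · intro β _ hβ
      by_cases hle : β.1 ≤ γ.1
      · have hlt : β.1.degree < n := by
          by_contra! hd
          exact hβ (Subtype.ext (eq_of_le_of_degree_le hle (by omega)))
        rw [ih _ hlt β rfl, Pi.zero_apply, zero_mul]
      · rw [prod_descFactorial_eq_zero hle, mul_zero, mul_zero]
    · simp

/-! ### Passage from endomorphisms to matrices -/

/-- An orthonormal basis of the range of `J` turns the norm pulled back along `J` into the Euclidean
one. -/
theorem exists_isometric_coordinates {V K : Type*} [AddCommGroup V] [Module ℂ V]
    [FiniteDimensional ℂ V] [NormedAddCommGroup K] [InnerProductSpace ℂ K] (J : V →ₗ[ℂ] K)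
    (hJ : Function.Injective J) :
    ∃ (n : ℕ) (Φ : V ≃ₗ[ℂ] (Fin n → ℂ)), ∀ v, ‖WithLp.toLp 2 (Φ v)‖ = ‖J v‖ := by
  let b := stdOrthonormalBasis ℂ (LinearMap.range J)
  refine ⟨_, LinearEquiv.ofInjective J hJ ≪≫ₗ b.repr.toLinearEquiv ≪≫ₗ WithLp.linearEquiv 2 ℂ _,
    fun v => ?_⟩
  exact b.repr.norm_map _

/-- The matrix of an endomorphism in given coordinates. -/
noncomputable def matrixIn {V : Type*} [AddCommGroup V] [Module ℂ V] {n : ℕ}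
    (Φ : V ≃ₗ[ℂ] (Fin n → ℂ)) : Module.End ℂ V ≃ₐ[ℂ] Matrix (Fin n) (Fin n) ℂ :=
  (Φ.conjAlgEquiv ℂ).trans LinearMap.toMatrixAlgEquiv'

theorem matrixIn_mulVec {V : Type*} [AddCommGroup V] [Module ℂ V] {n : ℕ}
    (Φ : V ≃ₗ[ℂ] (Fin n → ℂ)) (X : Module.End ℂ V) (v : V) :
    (matrixIn Φ X).mulVec (Φ v) = Φ (X v) := by
  rw [← Matrix.toLin'_apply]
  change Matrix.toLin' (LinearMap.toMatrix' (Φ.conjAlgEquiv ℂ X)) (Φ v) = _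
  rw [Matrix.toLin'_toMatrix']
  simp [LinearEquiv.conjAlgEquiv]

theorem norm_matrixIn_le {V : Type*} [AddCommGroup V] [Module ℂ V] {n : ℕ}
    (Φ : V ≃ₗ[ℂ] (Fin n → ℂ)) (X : Module.End ℂ V) {r : ℝ} (hr : 0 ≤ r)
    (h : ∀ v, ‖WithLp.toLp 2 (Φ (X v))‖ ≤ r * ‖WithLp.toLp 2 (Φ v)‖) : ‖matrixIn Φ X‖ ≤ r := by
  rw [Matrix.cstar_norm_def]
  refine ContinuousLinearMap.opNorm_le_bound _ hr fun x => ?_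
  have := h (Φ.symm x.ofLp)
  rwa [← matrixIn_mulVec, Φ.apply_symm_apply, ← Matrix.toEuclideanCLM_toLp,
    WithLp.toLp_ofLp] at this

theorem isCyclic_of_forall_invariant {d n : ℕ} {T : Fin d → Matrix (Fin n) (Fin n) ℂ}
    (hT : ∀ i j, Commute (T i) (T j)) (ξ : Fin n → ℂ)
    (h : ∀ W : Submodule ℂ (Fin n → ℂ), ξ ∈ W → (∀ i, ∀ w ∈ W, (T i).mulVec w ∈ W) → W = ⊤) :
    IsCyclic T := by
  have htop := h (Submodule.span ℂ (Set.range fun α => (monomial T α).mulVec ξ))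
    (Submodule.subset_span ⟨0, by simp [monomial_zero]⟩) (fun i w hw => by
      induction hw using Submodule.span_induction with
      | mem x hx =>
        obtain ⟨α, rfl⟩ := hx
        refine Submodule.subset_span ⟨α + single i 1, ?_⟩
        simp [monomial_add_single hT]
      | zero => simp
      | add x y _ _ hx hy => rw [Matrix.mulVec_add]; exact Submodule.add_mem _ hx hy
      | smul c x _ hx => rw [Matrix.mulVec_smul]; exact Submodule.smul_mem _ c hx)
  refine ⟨ξ, ?_⟩
  convert dense_univ
  refine Set.eq_univ_of_forall fun w => ?_
  have hw : w ∈ Submodule.span ℂ (Set.range fun α => (monomial T α).mulVec ξ) := htop ▸ trivial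
  obtain ⟨c, rfl⟩ := Finsupp.mem_span_range_iff_exists_finsupp.1 hw
  have hcoeff : ∀ β, (∑ α ∈ c.support, MvPolynomial.monomial α (c α)).coeff β = c β := fun β => by
    classical
    simp [MvPolynomial.coeff_sum, MvPolynomial.coeff_monomial, eq_comm]
  refine ⟨∑ α ∈ c.support, MvPolynomial.monomial α (c α), ?_⟩
  have hsupp : (∑ α ∈ c.support, MvPolynomial.monomial α (c α)).support = c.support := by
    ext β
    rw [MvPolynomial.mem_support_iff, hcoeff, Finsupp.mem_support_iff]
  simp only [polyEval, hsupp, hcoeff, Matrix.sum_mulVec, Matrix.smul_mulVec, Finsupp.sum]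

theorem jointlyDiagonalizable_of_linearEquiv {d n : ℕ} {T : Fin d → Matrix (Fin n) (Fin n) ℂ}
    (L : (Fin n → ℂ) ≃ₗ[ℂ] (Fin n → ℂ)) (D : Fin d → Fin n → ℂ)
    (h : ∀ i w, (T i).mulVec (L w) = L (D i * w)) : JointlyDiagonalizable T := by
  let S : (Matrix (Fin n) (Fin n) ℂ)ˣ :=
    ⟨LinearMap.toMatrix' L.toLinearMap, LinearMap.toMatrix' L.symm.toLinearMap,
      by rw [← LinearMap.toMatrix'_comp]; simp, by rw [← LinearMap.toMatrix'_comp]; simp⟩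
  have hS : ∀ w, S.val.mulVec w = L w := fun w => LinearMap.toMatrix'_mulVec L.toLinearMap w
  refine ⟨S, D, fun i => ?_⟩
  rw [Units.eq_mul_inv_iff_mul_eq]
  refine Matrix.toLin'.injective (LinearMap.ext fun w => ?_)
  rw [Matrix.toLin'_apply, Matrix.toLin'_apply, ← Matrix.mulVec_mulVec, ← Matrix.mulVec_mulVec,
    hS, hS, h]
  congr 1
  ext j
  simp [Matrix.mulVec_diagonal]

/-! ### Matrices of the deformed shifts -/

section Grid

variable {d N n : ℕ} (Φ : (MultiIndex d N → ℂ) ≃ₗ[ℂ] (Fin n → ℂ))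

theorem matrixIn_gridShift_commute (t : ℂ) (i j : Fin d) :
    Commute (matrixIn Φ (gridShift N t i)) (matrixIn Φ (gridShift N t j)) :=
  (gridShift_commute N t i j).map (matrixIn Φ)

theorem isCyclic_matrixIn_gridShift (t : ℂ) : IsCyclic fun i => matrixIn Φ (gridShift N t i) := by
  refine isCyclic_of_forall_invariant (matrixIn_gridShift_commute Φ t) (Φ (truncMonomial N 0))
    fun W h0 hW => ?_
  have := eq_top_of_gridShift_invariant N t (W.comap Φ.toLinearMap) h0 fun i v hv => by
    have := hW i _ hv
    rwa [LinearEquiv.coe_coe, matrixIn_mulVec] at this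
  rw [eq_top_iff]
  intro w _
  have hw : Φ.symm w ∈ W.comap Φ.toLinearMap := this ▸ trivial
  simpa using hw

/-- For `t ≠ 0`, `gridEval` identifies the space with functions on the grid; point masses are joint
eigenvectors, with eigenvalues the grid points `t γ`. -/
theorem jointlyDiagonalizable_matrixIn_gridShift {t : ℂ} (ht : t ≠ 0) :
    JointlyDiagonalizable fun i => matrixIn Φ (gridShift N t i) := by
  have hcard : Fintype.card (MultiIndex d N) = Fintype.card (Fin n) := by
    simpa using Φ.finrank_eq
  let σ : MultiIndex d N ≃ Fin n := Fintype.equivOfCardEq hcard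
  let E := LinearEquiv.ofInjectiveEndo (gridEval d N t) (gridEval_injective d N ht)
  refine jointlyDiagonalizable_of_linearEquiv (LinearEquiv.funCongrLeft ℂ ℂ σ ≪≫ₗ E.symm ≪≫ₗ Φ)
    (fun i k => t * (σ.symm k).1 i) fun i w => ?_
  simp only [LinearEquiv.trans_apply, matrixIn_mulVec]
  congr 1
  rw [LinearEquiv.eq_symm_apply]
  funext γ
  have h := gridEval_gridShift N t i (E.symm (LinearEquiv.funCongrLeft ℂ ℂ σ w)) γ
  have h2 : gridEval d N t (E.symm (LinearEquiv.funCongrLeft ℂ ℂ σ w)) =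
    LinearEquiv.funCongrLeft ℂ ℂ σ w := E.apply_symm_apply _
  rw [h2] at h
  refine h.trans ?_
  simp [LinearEquiv.funCongrLeft_apply, LinearMap.funLeft_apply]

theorem jointlyNilpotent_matrixIn_gridShift :
    JointlyNilpotent fun i => matrixIn Φ (gridShift N (0 : ℂ) i) := by
  refine ⟨N, fun α hα => ?_⟩
  rw [← map_monomial, funext (gridShift_zero N),
    monomial_truncShift_eq_zero (by rwa [degree_eq_sum_univ]), map_zero]

theorem tendsto_matrixIn_gridShift :
    Filter.Tendsto (fun (t : ℂ) i => matrixIn Φ (gridShift (d := d) N t i)) (nhds 0)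
      (nhds fun i => matrixIn Φ (gridShift N 0 i)) := by
  have : Continuous fun (t : ℂ) (i : Fin d) => matrixIn Φ (gridShift N t i) := by
    simp only [gridShift, map_add, map_smul]
    fun_prop
  exact this.tendsto 0

end Grid

/-! ### The nilpotent model of a Hilbert space tuple -/

section Model

variable {d : ℕ} {H : Type*} [NormedAddCommGroup H] [InnerProductSpace ℂ H]

/-- The orbit of `ξ` under the tuple `T ⊗ S ⊕ r S'` of truncated weighted shifts. -/
noncomputable def modelVec (T : Fin d → H →L[ℂ] H) (ξ : H) (r ε : ℝ) (N : ℕ) (α : Fin d →₀ ℕ) :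
    Fin N ⊕ MultiIndex d N → H :=
  Sum.elim (fun j => if α.degree ≤ j then monomial T α ξ else 0)
    (fun γ => if γ.1 = α then ((ε * r ^ α.degree : ℝ) : ℂ) • ξ else 0)

theorem modelVec_of_le (T : Fin d → H →L[ℂ] H) (ξ : H) (r ε : ℝ) {N : ℕ} {α : Fin d →₀ ℕ}
    (h : N ≤ α.degree) : modelVec T ξ r ε N α = 0 := by
  funext x
  rcases x with j | γ
  · exact if_neg (by have := j.2; omega)
  · exact if_neg (by rintro rfl; have := γ.2; omega)

theorem degree_sub_single_lt {N : ℕ} (γ : MultiIndex d N) (i : Fin d) :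
    (γ.1 - single i 1).degree < N :=
  (Finsupp.degree_mono tsub_le_self).trans_lt γ.2

/-- The operator `T i ⊗ S ⊕ r S' i`. -/
noncomputable def modelShift (T : Fin d → H →L[ℂ] H) (r : ℝ) (N : ℕ) (i : Fin d) :
    (Fin N ⊕ MultiIndex d N → H) →ₗ[ℂ] (Fin N ⊕ MultiIndex d N → H) :=
  LinearMap.pi <| Sum.elim
    (fun j => if j.1 ≠ 0 then (T i).toLinearMap ∘ₗ
      LinearMap.proj (Sum.inl ⟨j.1 - 1, by have := j.2; omega⟩) else 0)
    (fun γ => if γ.1 i ≠ 0 then (r : ℂ) •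
      LinearMap.proj (Sum.inr ⟨γ.1 - single i 1, degree_sub_single_lt γ i⟩) else 0)

theorem modelShift_modelVec {T : Fin d → H →L[ℂ] H} (hT : ∀ i j, Commute (T i) (T j)) (ξ : H)
    (r ε : ℝ) (N : ℕ) (i : Fin d) (α : Fin d →₀ ℕ) :
    modelShift T r N i (modelVec T ξ r ε N α) = modelVec T ξ r ε N (α + single i 1) := by
  funext x
  rcases x with j | γ
  · by_cases hj : j.1 = 0
    · simp [modelShift, modelVec, hj]
    · have h1 : α.degree ≤ j.1 - 1 ↔ α.degree + 1 ≤ j.1 := by omega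
      simp [modelShift, modelVec, hj, monomial_add_single hT, h1, apply_ite (T i)]
  · by_cases hγ : γ.1 i = 0
    · have : γ.1 ≠ α + single i 1 := fun h => by
        rw [h] at hγ
        simp at hγ
      simp [modelShift, modelVec, hγ, this]
    · have h1 : γ.1 - single i 1 = α ↔ γ.1 = α + single i 1 :=
        tsub_eq_iff_eq_add_of_le (Finsupp.single_le_iff.2 (Nat.one_le_iff_ne_zero.2 hγ))
      simp only [modelShift, modelVec, LinearMap.pi_apply, Sum.elim_inr, ne_eq, hγ,
        not_false_eq_true, if_true, LinearMap.smul_apply, LinearMap.proj_apply, h1, smul_ite,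
        smul_zero, smul_smul, map_add, Finsupp.degree_single]
      congr 2
      push_cast
      ring

theorem sum_shift_le {ι : Type*} [Fintype ι] (p : ι → Prop) [DecidablePred p] (σ : ι → ι)
    (hσ : ∀ x y, p x → p y → σ x = σ y → x = y) (g : ι → ℝ) (hg : ∀ x, 0 ≤ g x) :
    ∑ x, (if p x then g (σ x) else 0) ≤ ∑ x, g x := by
  classical
  rw [← Finset.sum_filter, ← Finset.sum_image (f := g) (g := σ) fun x hx y hy =>
    hσ x y (Finset.mem_filter.1 hx).2 (Finset.mem_filter.1 hy).2]
  exact Finset.sum_le_sum_of_subset_of_nonneg (Finset.subset_univ _) fun x _ _ => hg x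

theorem sum_norm_modelShift_le {T : Fin d → H →L[ℂ] H} {r : ℝ}
    (hTr : ∀ i, ‖T i‖ ≤ r) (N : ℕ) (i : Fin d) (h : Fin N ⊕ MultiIndex d N → H) :
    ∑ x, ‖modelShift T r N i h x‖ ^ 2 ≤ r ^ 2 * ∑ x, ‖h x‖ ^ 2 := by
  rw [Fintype.sum_sum_type, Fintype.sum_sum_type, mul_add, Finset.mul_sum, Finset.mul_sum]
  refine add_le_add ?_ ?_
  · refine le_trans (Finset.sum_le_sum fun j _ => ?_) (sum_shift_le (fun j : Fin N => j.1 ≠ 0)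
      (fun j => ⟨j.1 - 1, by have := j.2; omega⟩) (fun x y hx hy hxy => ?_)
      (fun j => r ^ 2 * ‖h (Sum.inl j)‖ ^ 2) fun x => by positivity)
    · by_cases hj : j.1 = 0
      · simp [modelShift, hj]
      · simp only [modelShift, LinearMap.pi_apply, Sum.elim_inl, ne_eq, hj, not_false_eq_true,
          if_true, LinearMap.comp_apply, LinearMap.proj_apply, ← mul_pow]
        exact pow_le_pow_left₀ (norm_nonneg _) ((T i).le_of_opNorm_le (hTr i) _) 2
    · have := Fin.mk.inj_iff.1 hxy
      exact Fin.ext (by omega)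
  · refine le_trans (Finset.sum_le_sum fun γ _ => ?_)
      (sum_shift_le (fun γ : MultiIndex d N => γ.1 i ≠ 0)
      (fun γ => ⟨γ.1 - single i 1, degree_sub_single_lt γ i⟩) (fun x y hx hy hxy => ?_)
      (fun γ => r ^ 2 * ‖h (Sum.inr γ)‖ ^ 2) fun x => by positivity)
    · by_cases hγ : γ.1 i = 0
      · simp [modelShift, hγ]
      · simp [modelShift, hγ, norm_smul, mul_pow]
    · have h1 := congrArg (· + single i 1) (Subtype.mk.inj hxy)
      rw [tsub_add_cancel_of_le (Finsupp.single_le_iff.2 (Nat.one_le_iff_ne_zero.2 hx)),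
        tsub_add_cancel_of_le (Finsupp.single_le_iff.2 (Nat.one_le_iff_ne_zero.2 hy))] at h1
      exact Subtype.ext h1

/-- The multi-indices of degree at most `j`. -/
noncomputable def degreeLE (d j : ℕ) : Finset (Fin d →₀ ℕ) :=
  (Finsupp.finite_of_degree_le j).toFinset

theorem mem_degreeLE {j : ℕ} {α : Fin d →₀ ℕ} : α ∈ degreeLE d j ↔ α.degree ≤ j := by
  simp [degreeLE]

theorem tendsto_degreeLE (d : ℕ) : Filter.Tendsto (degreeLE d) Filter.atTop Filter.atTop :=
  Filter.tendsto_atTop_finset_of_monotone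
    (fun _ _ hjk _ hα => mem_degreeLE.2 ((mem_degreeLE.1 hα).trans hjk))
    fun α => ⟨α.degree, mem_degreeLE.2 le_rfl⟩

/-- The norm is pulled back along `z^α ↦ modelVec α`, which intertwines `truncShift` with
`modelShift`. Slot `j` of the image of a polynomial is its part of degree `≤ j`, evaluated at `T` on
`ξ`. -/
theorem exists_model {T : Fin d → H →L[ℂ] H} (hT : ∀ i j, Commute (T i) (T j)) {r : ℝ}
    (hr : 0 < r) (hTr : ∀ i, ‖T i‖ ≤ r) {ξ : H} (hξ : ξ ≠ 0) {ε : ℝ} (hε : 0 < ε) {N : ℕ}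
    (hN : 0 < N) :
    ∃ (n : ℕ) (Φ : (MultiIndex d N → ℂ) ≃ₗ[ℂ] (Fin n → ℂ)),
      (∀ i v, ‖WithLp.toLp 2 (Φ (truncShift N i v))‖ ≤ r * ‖WithLp.toLp 2 (Φ v)‖) ∧
      ‖WithLp.toLp 2 (Φ (truncMonomial N 0))‖ ^ 2 = (N + ε ^ 2) * ‖ξ‖ ^ 2 ∧
      ∀ a : (Fin d →₀ ℕ) → ℂ,
        ∑ j ∈ Finset.range N, ‖∑ α ∈ degreeLE d j, a α • monomial T α ξ‖ ^ 2 ≤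
          ‖WithLp.toLp 2 (Φ fun β => a β.1)‖ ^ 2 := by
  let J' := truncLift N (modelVec T ξ r ε N)
  let J : (MultiIndex d N → ℂ) →ₗ[ℂ] PiLp 2 (fun _ : Fin N ⊕ MultiIndex d N => H) :=
    (WithLp.linearEquiv 2 ℂ (Fin N ⊕ MultiIndex d N → H)).symm.toLinearMap ∘ₗ J'
  have hJnorm : ∀ v, ‖J v‖ ^ 2 = ∑ x, ‖J' v x‖ ^ 2 := fun v => PiLp.norm_sq_eq_of_L2 _ _
  have hJe : ∀ α, J' (truncMonomial N α) = modelVec T ξ r ε N α :=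
    truncLift_truncMonomial fun α h => modelVec_of_le T ξ r ε h
  have hJr : ∀ v β, J' v (Sum.inr β) = (v β * ((ε * r ^ β.1.degree : ℝ) : ℂ)) • ξ := by
    intro v β
    simp only [J', truncLift_apply, Finset.sum_apply, Pi.smul_apply, modelVec, Sum.elim_inr]
    rw [Finset.sum_eq_single β]
    · rw [if_pos rfl, smul_smul]
    · intro γ _ hγ
      rw [if_neg fun h => hγ (Subtype.ext h).symm, smul_zero]
    · simp
  have hJl : ∀ (a : (Fin d →₀ ℕ) → ℂ) (j : Fin N), J' (fun β => a β.1) (Sum.inl j) =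
      ∑ α ∈ degreeLE d j, a α • monomial T α ξ := by
    intro a j
    simp only [J', truncLift_apply, Finset.sum_apply, Pi.smul_apply, modelVec, Sum.elim_inl,
      smul_ite, smul_zero]
    rw [← Finset.sum_filter]
    refine Finset.sum_bij (fun β _ => β.1) (fun β hβ => ?_) (fun β _ γ _ h => Subtype.ext h)
      (fun α hα => ?_) fun _ _ => rfl
    · exact mem_degreeLE.2 (Finset.mem_filter.1 hβ).2
    · have := mem_degreeLE.1 hα
      exact ⟨⟨α, this.trans_lt j.2⟩, by simpa using this, rfl⟩
  -- The second summand exists for this: its coordinate at `β` is `v β` times a nonzero multiple of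
  -- `ξ`.
  have hinj : Function.Injective J := by
    rw [injective_iff_map_eq_zero]
    intro v hv
    have hv' : J' v = 0 := (WithLp.linearEquiv 2 ℂ _).symm.map_eq_zero_iff.1 hv
    funext β
    have := hJr v β
    rw [hv', Pi.zero_apply, eq_comm, smul_eq_zero_iff_left hξ, mul_eq_zero] at this
    refine this.resolve_right ?_
    exact_mod_cast (by positivity : ε * r ^ β.1.degree ≠ 0)
  obtain ⟨n, Φ, hΦ⟩ := exists_isometric_coordinates J hinj
  refine ⟨n, Φ, fun i v => ?_, ?_, fun a => ?_⟩
  · rw [hΦ, hΦ]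
    refine le_of_sq_le_sq ?_ (by positivity)
    rw [mul_pow, hJnorm, hJnorm]
    have : J' (truncShift N i v) = modelShift T r N i (J' v) := by
      suffices h : J' ∘ₗ truncShift N i = modelShift T r N i ∘ₗ J' from LinearMap.congr_fun h v
      refine linearMap_ext_truncMonomial fun α => ?_
      rw [LinearMap.comp_apply, LinearMap.comp_apply, truncShift_apply, hJe, hJe,
        modelShift_modelVec hT]
    rw [this]
    exact sum_norm_modelShift_le hTr N i _
  · have h2 : ∑ γ : MultiIndex d N, ‖modelVec T ξ r ε N 0 (Sum.inr γ)‖ ^ 2 = ε ^ 2 * ‖ξ‖ ^ 2 := by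
      rw [Fintype.sum_eq_single ⟨0, by simpa using hN⟩]
      · simp [modelVec, norm_smul, mul_pow]
      · intro γ hγ
        have : γ.1 ≠ 0 := fun h => hγ (Subtype.ext h)
        simp [modelVec, this]
    rw [hΦ, hJnorm, hJe, Fintype.sum_sum_type, h2]
    simp [modelVec, monomial_zero]
    ring
  · rw [hΦ, hJnorm, Fintype.sum_sum_type, ← Fin.sum_univ_eq_sum_range
      (fun j => ‖∑ α ∈ degreeLE d j, a α • monomial T α ξ‖ ^ 2)]
    simp only [hJl]
    exact le_add_of_nonneg_right (Finset.sum_nonneg fun _ _ => by positivity)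

end Model

/-! ### Comparison of norms and passage to the limit -/

open Filter Topology

/-- By nilpotency the series is a finite sum, and applied to `1` it gives the truncated Taylor
polynomial of `f`. -/
theorem holoEval_matrixIn_mulVec {d N n : ℕ} (Φ : (MultiIndex d N → ℂ) ≃ₗ[ℂ] (Fin n → ℂ))
    (f : (Fin d → ℂ) → ℂ) :
    (holoEval f fun i => matrixIn Φ (gridShift N (0 : ℂ) i)).mulVec (Φ (truncMonomial N 0)) =
      Φ fun β => taylorCoeff f β.1 := by
  have h1 : ∀ α, monomial (fun i => matrixIn Φ (gridShift N (0 : ℂ) i)) α =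
      matrixIn Φ (monomial (truncShift N) α) := fun α => by
    rw [map_monomial]
    simp only [gridShift_zero]
  have h2 : holoEval f (fun i => matrixIn Φ (gridShift N (0 : ℂ) i)) =
      matrixIn Φ (∑ α ∈ degreeLE d N, taylorCoeff f α • monomial (truncShift N) α) := by
    rw [holoEval, map_sum]
    simp only [h1, map_smul]
    refine tsum_eq_sum fun α hα => ?_
    rw [mem_degreeLE, not_le] at hα
    rw [monomial_truncShift_eq_zero hα.le, map_zero, smul_zero]
  rw [h2, matrixIn_mulVec, LinearMap.sum_apply]
  congr 1
  funext β
  rw [Finset.sum_apply, Finset.sum_eq_single β.1]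
  · simp [monomial_truncShift_apply, ← basisFun_eq_truncMonomial]
  · intro α _ hα
    rw [LinearMap.smul_apply, monomial_truncShift_apply, add_zero]
    by_cases h : α.degree < N
    · have : β ≠ ⟨α, h⟩ := fun h => hα (congrArg Subtype.val h).symm
      simp [truncMonomial, h, this]
    · simp [truncMonomial, h]
  · intro hβ
    exact absurd (mem_degreeLE.2 β.2.le) hβ

/-- The Cesàro means of `‖s j‖ ^ 2` tend to `‖x‖ ^ 2 > c ^ 2`. -/
theorem exists_lt_sum_norm_sq {E : Type*} [NormedAddCommGroup E] {s : ℕ → E} {x : E}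
    (hs : Tendsto s atTop (𝓝 x)) {c : ℝ} (hc : 0 ≤ c) (hcx : c < ‖x‖) :
    ∃ N : ℕ, 0 < N ∧ N * c ^ 2 < ∑ j ∈ Finset.range N, ‖s j‖ ^ 2 := by
  have h := (hs.norm.pow 2).cesaro.eventually_const_lt (pow_lt_pow_left₀ hcx hc two_ne_zero)
  obtain ⟨N, hN, hN0⟩ := (h.and (eventually_gt_atTop 0)).exists
  refine ⟨N, hN0, ?_⟩
  have hN' : (0 : ℝ) < N := by exact_mod_cast hN0
  rwa [inv_mul_eq_div, lt_div_iff₀ hN', mul_comm] at hN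

theorem exists_gridShift_lt_norm_holoEval {d : ℕ} {f : (Fin d → ℂ) → ℂ} {C : ℝ}
    (hC : ∀ α, ‖taylorCoeff f α‖ ≤ C) {H : Type*} [NormedAddCommGroup H] [InnerProductSpace ℂ H]
    [CompleteSpace H] {T : Fin d → H →L[ℂ] H} (hT : IsCommutingStrict T) {c : ℝ} (hc : 0 ≤ c)
    (hcf : c < ‖holoEval f T‖) :
    ∃ (N n : ℕ) (Φ : (MultiIndex d N → ℂ) ≃ₗ[ℂ] (Fin n → ℂ)),
      (∀ i, ‖matrixIn Φ (gridShift N (0 : ℂ) i)‖ < 1) ∧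
      c < ‖holoEval f fun i => matrixIn Φ (gridShift N (0 : ℂ) i)‖ := by
  obtain ⟨r, hr, hr1, hTr⟩ : ∃ r : ℝ, 0 < r ∧ r < 1 ∧ ∀ i, ‖T i‖ ≤ r := by
    obtain ⟨r, hr1, hr⟩ := exists_between ((pi_norm_lt_iff one_pos).2 hT.2)
    exact ⟨r, (norm_nonneg _).trans_lt hr1, hr, fun i => (norm_le_pi_norm T i).trans hr1.le⟩
  obtain ⟨ξ, hξ1, hξ⟩ := ContinuousLinearMap.exists_lt_apply_of_lt_opNorm _ hcf
  have hξ0 : ξ ≠ 0 := by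
    rintro rfl
    rw [map_zero, norm_zero] at hξ
    exact hξ.not_ge hc
  have hsum := (summable_holoEval ContinuousLinearMap.norm_id_le hC hT.1 hr.le hr1 hTr).hasSum
  have hlim : Tendsto (fun j => ∑ α ∈ degreeLE d j, taylorCoeff f α • monomial T α ξ) atTop
      (𝓝 (holoEval f T ξ)) := by
    have := hsum.mapL (ContinuousLinearMap.apply ℂ H ξ)
    rw [HasSum, SummationFilter.unconditional_filter] at this
    exact this.comp (tendsto_degreeLE d)
  obtain ⟨N, hN, hNs⟩ := exists_lt_sum_norm_sq hlim hc hξ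
  -- The inequality for `N` is strict, so it survives the small extra mass `ε ^ 2` of the starting
  -- vector.
  obtain ⟨ε, hε, hεs⟩ : ∃ ε : ℝ, 0 < ε ∧ (N + ε ^ 2) * c ^ 2 <
      ∑ j ∈ Finset.range N, ‖∑ α ∈ degreeLE d j, taylorCoeff f α • monomial T α ξ‖ ^ 2 := by
    have h : Tendsto (fun ε : ℝ => (N + ε ^ 2) * c ^ 2) (𝓝[>] 0) (𝓝 ((N + 0 ^ 2) * c ^ 2)) :=
      ((by fun_prop : Continuous fun ε : ℝ => (N + ε ^ 2) * c ^ 2).tendsto 0).mono_left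
        nhdsWithin_le_nhds
    obtain ⟨ε, h1, h2⟩ := ((h.eventually_lt_const (by simpa using hNs)).and
      self_mem_nhdsWithin).exists
    exact ⟨ε, h2, h1⟩
  obtain ⟨n, Φ, hΦr, hΦ0, hΦf⟩ := exists_model hT.1 hr hTr hξ0 hε hN
  refine ⟨N, n, Φ, fun i => ?_, ?_⟩
  · rw [gridShift_zero]
    exact (norm_matrixIn_le Φ _ hr.le (hΦr i)).trans_lt hr1
  · set A := holoEval f fun i => matrixIn Φ (gridShift N (0 : ℂ) i) with hA
    by_contra! hle
    have h1 : ‖WithLp.toLp 2 (Φ fun β => taylorCoeff f β.1)‖ ≤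
        c * ‖WithLp.toLp 2 (Φ (truncMonomial N 0))‖ := by
      rw [← holoEval_matrixIn_mulVec, ← hA]
      exact (Matrix.l2_opNorm_mulVec A (WithLp.toLp 2 (Φ (truncMonomial N 0)))).trans
        (mul_le_mul_of_nonneg_right hle (norm_nonneg _))
    have h2 := pow_le_pow_left₀ (norm_nonneg _) h1 2
    rw [mul_pow, hΦ0] at h2
    have h3 := hΦf (taylorCoeff f)
    have h4 : c ^ 2 * ((N + ε ^ 2) * ‖ξ‖ ^ 2) ≤ (N + ε ^ 2) * c ^ 2 := by
      have : ‖ξ‖ ^ 2 ≤ 1 := pow_le_one₀ (norm_nonneg _) hξ1.le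
      have h0 : 0 ≤ (N + ε ^ 2) * c ^ 2 := by positivity
      nlinarith
    linarith

/-- Norm bounds and `c < ‖f(T)‖` are open conditions at `t = 0`, so `P` is needed only for some `t`
arbitrarily near `0`: `t = 0` itself for nilpotency, `t ≠ 0` for diagonalizability. -/
theorem schurAglerNorm_le_iSup {d : ℕ} {f : (Fin d → ℂ) → ℂ} (hf : IsHInfty f)
    (P : ∀ n : ℕ, (Fin d → Matrix (Fin n) (Fin n) ℂ) → Prop)
    (hP : ∀ (N n : ℕ) (Φ : (MultiIndex d N → ℂ) ≃ₗ[ℂ] (Fin n → ℂ)),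
      ∃ᶠ t in 𝓝 (0 : ℂ), P n fun i => matrixIn Φ (gridShift N t i)) :
    schurAglerNorm.{u} f ≤ ⨆ (n : ℕ) (T : Fin d → Matrix (Fin n) (Fin n) ℂ)
      (_ : T ∈ cyclicTuples d n) (_ : P n T), ‖holoEval f T‖ₑ := by
  obtain ⟨C, hC⟩ := hf.exists_norm_taylorCoeff_le
  refine iSup_le fun H => iSup_le fun _ => iSup_le fun _ => iSup_le fun _ => iSup_le fun T =>
    iSup_le fun hT => le_of_forall_lt fun c hc => ?_
  lift c to NNReal using hc.ne_top
  have hc' : (c : ℝ) < ‖holoEval f T‖ := by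
    rw [enorm_eq_nnnorm, ENNReal.coe_lt_coe] at hc
    exact_mod_cast hc
  obtain ⟨N, n, Φ, hnorm, hlt⟩ := exists_gridShift_lt_norm_holoEval hC hT c.2 hc'
  have hone : ‖(1 : Matrix (Fin n) (Fin n) ℂ)‖ ≤ 1 := by
    rw [Matrix.cstar_norm_def, map_one]
    exact ContinuousLinearMap.norm_id_le
  have hlim := tendsto_matrixIn_gridShift (d := d) Φ
  have h1 := (tendsto_holoEval hone hC (matrixIn_gridShift_commute Φ) hlim hnorm).norm
  have h2 : ∀ᶠ t in 𝓝 (0 : ℂ), ∀ i, ‖matrixIn Φ (gridShift N t i)‖ < 1 :=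
    Filter.eventually_all.2 fun i =>
      ((tendsto_pi_nhds.1 hlim) i).norm.eventually_lt_const (hnorm i)
  obtain ⟨t, hPt, hts, htf⟩ := ((hP N n Φ).and_eventually
    (h2.and (h1.eventually_const_lt hlt))).exists
  have hmem : (fun i => matrixIn Φ (gridShift N t i)) ∈ cyclicTuples d n :=
    ⟨⟨matrixIn_gridShift_commute Φ t, hts⟩, isCyclic_matrixIn_gridShift Φ t⟩
  refine lt_of_lt_of_le ?_ (le_iSup_of_le n <| le_iSup_of_le _ <| le_iSup_of_le hmem <|
    le_iSup_of_le hPt le_rfl)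
  rw [enorm_eq_nnnorm, ENNReal.coe_lt_coe]
  exact_mod_cast htf

theorem frequently_jointlyDiagonalizable {d N n : ℕ}
    (Φ : (MultiIndex d N → ℂ) ≃ₗ[ℂ] (Fin n → ℂ)) :
    ∃ᶠ t in 𝓝 (0 : ℂ), JointlyDiagonalizable fun i => matrixIn Φ (gridShift (d := d) N t i) := by
  have h : ∀ᶠ t in 𝓝[≠] (0 : ℂ),
      JointlyDiagonalizable fun i => matrixIn Φ (gridShift (d := d) N t i) :=
    eventually_mem_nhdsWithin.mono fun t ht => jointlyDiagonalizable_matrixIn_gridShift Φ ht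
  exact h.frequently.filter_mono nhdsWithin_le_nhds

theorem iSup_le_schurAglerNorm {d : ℕ} (f : (Fin d → ℂ) → ℂ)
    (P : ∀ n : ℕ, (Fin d → Matrix (Fin n) (Fin n) ℂ) → Prop) :
    (⨆ (n : ℕ) (T : Fin d → Matrix (Fin n) (Fin n) ℂ)
      (_ : T ∈ cyclicTuples d n) (_ : P n T), ‖holoEval f T‖ₑ) ≤ schurAglerNorm.{u} f :=
  iSup_le fun _ => iSup_le fun _ => iSup_le fun hT => iSup_le fun _ =>
    enorm_holoEval_le_schurAglerNorm f hT.1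

end SchurAgler

theorem mainTheorem5 (d : ℕ) (f : (Fin d → ℂ) → ℂ) (hf : SchurAgler.IsHInfty f) :
    SchurAgler.schurAglerNorm.{u} f =
        (⨆ (n : ℕ) (T : Fin d → Matrix (Fin n) (Fin n) ℂ)
          (_ : T ∈ SchurAgler.cyclicTuples d n) (_ : SchurAgler.JointlyNilpotent T),
          ‖SchurAgler.holoEval f T‖ₑ) ∧
      SchurAgler.schurAglerNorm.{u} f =
        (⨆ (n : ℕ) (T : Fin d → Matrix (Fin n) (Fin n) ℂ)
          (_ : T ∈ SchurAgler.cyclicTuples d n) (_ : SchurAgler.JointlyDiagonalizable T),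
          ‖SchurAgler.holoEval f T‖ₑ) := by
  constructor
  · refine le_antisymm (SchurAgler.schurAglerNorm_le_iSup hf
      (fun n T => SchurAgler.JointlyNilpotent T) fun N n Φ => ?_)
      (SchurAgler.iSup_le_schurAglerNorm f fun n T => SchurAgler.JointlyNilpotent T)
    exact fun h => h.self_of_nhds (SchurAgler.jointlyNilpotent_matrixIn_gridShift Φ)
  · refine le_antisymm (SchurAgler.schurAglerNorm_le_iSup hf
      (fun n T => SchurAgler.JointlyDiagonalizable T) fun N n Φ => ?_)
      (SchurAgler.iSup_le_schurAglerNorm f fun n T => SchurAgler.JointlyDiagonalizable T)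
    exact SchurAgler.frequently_jointlyDiagonalizable Φ
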